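/- Let $R$ be a commutative ring; sheaves are sheaves of $R$-modules, $D^+(X)$ and $D^b(X)$ denote the bounded below and the bounded derived category of sheaves on a space $X$. A stratification $\mathcal S$ of a topological space $X$ is a finite partition of $X$ into (nonempty) locally closed subsets, the strata, each of which is a simply connected topological manifold, such that the closure of every stratum is a union of strata. The set $\mathcal S$ of strata carries the final topology with respect to the projection $p\colon X\to\mathcal S$ that sends a point to the stratum containing it. The star of a stratum $A$ is the open set $\mathrm{St}(A)=\bigcup_{B\in\mathcal S,\ A\subset\overline B}B$. A sheaf on $X$ is weakly constructible if its restriction to every stratum is a constant sheaf, and $D^+_{w,c}(X)\subset D^+(X)$, $D^b_{w,c}(X)\subset D^b(X)$ are the full subcategories of complexes all of whose cohomology sheaves are weakly constructible. The stratification is called acyclic if for every weakly constructible sheaf $\mathcal F$ and every stratum $A$ (1) the natural map $\Gamma(\mathrm{St}(A),\mathcal F)\to\mathcal F_x$ is an isomorphism for every $x\in A$, and (2) $H^i(\mathrm{St}(A),\mathcal F)=0$ for all $i>0$. Let $\mathcal S$ be an acyclic stratification of a topological space $X$. Then the adjoint pair $p^*\colon D^+(\mathcal S)\rightleftarrows D^+(X)\colon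 Rp_*$ (with $p^*$ left adjoint to $Rp_*$) induces mutually quasi-inverse equivalences of categories $$D^+_{w,c}(X)\ \underset{p^*}{\overset{Rp_*}{\rightleftarrows}}\ D^+(\mathcal S),$$ that is, $p^*$ takes values in $D^+_{w,c}(X)$, and the unit $\mathrm{id}\to Rp_*p^*$ on $D^+(\mathcal S)$ and the counit $p^*Rp_*\to\mathrm{id}$ on $D^+_{w,c}(X)$ are isomorphisms. Moreover, these functors restrict to mutually quasi-inverse equivalences $$D^b_{w,c}(X)\ \underset{p^*}{\overset{Rp_*}{\rightleftarrows}}\ D^b(\mathcal S);$$ no further condition on $X$ is imposed here, so that this holds in particular if $X$ has finite homological dimension. -/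

import Mathlib

open CategoryTheory Limits TopologicalSpace Opposite

universe w w₁ w₂ v₁ v₂ v₃ v₄ u₁ u₂ u₃ u₄ u

noncomputable section

namespace CategoryTheory

/-! ### Equivalences induced by an adjunction -/

/-- Let `adj : G ⊣ F` be an adjunction between `C` and `D`, and let `iC : C' ⥤ C`, `iD : D' ⥤ D`
be (inclusions of) full subcategories. The adjoint pair `(G, F)` induces an equivalence
between `D'` and `C'` if there is an equivalence `e : D' ≌ C'` whose functor is the
restriction of `F`, whose inverse is the restriction of `G`, and whose structural isomorphisms
`𝟭 ≅ e.inverse ⋙ e.functor` and `e.functor ⋙ e.inverse ≅ 𝟭` are the restrictions of the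
unit and of the counit of `adj`. -/
def Adjunction.InducesEquivalence {C : Type u₁} [Category.{v₁} C] {D : Type u₂} [Category.{v₂} D]
    {C' : Type u₃} [Category.{v₃} C'] {D' : Type u₄} [Category.{v₄} D']
    {G : C ⥤ D} {F : D ⥤ C} (adj : G ⊣ F) (iC : C' ⥤ C) (iD : D' ⥤ D) : Prop :=
  ∃ (e : D' ≌ C') (α : e.inverse ⋙ iD ≅ iC ⋙ G) (β : e.functor ⋙ iC ≅ iD ⋙ F),
    (∀ X : C', iC.map (e.counitIso.inv.app X) ≫ β.hom.app (e.inverse.obj X) =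
      adj.unit.app (iC.obj X) ≫ F.map (α.inv.app X)) ∧
    (∀ Y : D', G.map (β.inv.app Y) ≫ α.inv.app (e.functor.obj Y) ≫ iD.map (e.unitIso.inv.app Y) =
      adj.counit.app (iD.obj Y))

/-! ### Derived adjunctions -/

section HomotopyCategory

variable {C : Type u₁} [Category.{v₁} C] [Preadditive C]
  {D : Type u₂} [Category.{v₂} D] [Preadditive D]
  {G : C ⥤ D} {F : D ⥤ C} [G.Additive] [F.Additive]

/-- An adjunction between additive functors, applied degreewise to complexes. -/
def Adjunction.mapCochainComplex (adj : G ⊣ F) :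
    G.mapHomologicalComplex (ComplexShape.up ℤ) ⊣ F.mapHomologicalComplex (ComplexShape.up ℤ) where
  unit :=
    { app := fun K =>
        { f := fun i => adj.unit.app (K.X i)
          comm' := fun i j _ => (adj.unit.naturality (K.d i j)).symm }
      naturality := fun K L f => by
        ext i
        exact adj.unit.naturality (f.f i) }
  counit :=
    { app := fun K =>
        { f := fun i => adj.counit.app (K.X i)
          comm' := fun i j _ => (adj.counit.naturality (K.d i j)).symm }
      naturality := fun K L f => by
        ext i
        exact adj.counit.naturality (f.f i) }
  left_triangle_components K := by
    ext i
    exact adj.left_triangle_components (K.X i)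
  right_triangle_components K := by
    ext i
    exact adj.right_triangle_components (K.X i)

/-- The adjunction between homotopy categories of complexes induced by
an adjunction between additive functors. -/
def Adjunction.mapHomotopyCategory (adj : G ⊣ F) :
    G.mapHomotopyCategory (ComplexShape.up ℤ) ⊣ F.mapHomotopyCategory (ComplexShape.up ℤ) where
  unit :=
    { app := fun K => (HomotopyCategory.quotient C _).map (adj.mapCochainComplex.unit.app K.as)
      naturality := by
        rintro ⟨K⟩ ⟨L⟩ f
        obtain ⟨f, rfl⟩ := (HomotopyCategory.quotient C _).map_surjective f
        exact congrArg (HomotopyCategory.quotient C _).map (adj.mapCochainComplex.unit.naturality f) }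
  counit :=
    { app := fun K => (HomotopyCategory.quotient D _).map (adj.mapCochainComplex.counit.app K.as)
      naturality := by
        rintro ⟨K⟩ ⟨L⟩ f
        obtain ⟨f, rfl⟩ := (HomotopyCategory.quotient D _).map_surjective f
        exact congrArg (HomotopyCategory.quotient D _).map
          (adj.mapCochainComplex.counit.naturality f) }
  left_triangle_components K :=
    congrArg (HomotopyCategory.quotient D _).map
      (adj.mapCochainComplex.left_triangle_components K.as)
  right_triangle_components K :=
    congrArg (HomotopyCategory.quotient C _).map
      (adj.mapCochainComplex.right_triangle_components K.as)

/-- The adjunction between homotopy categories of bounded below complexes induced by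
an adjunction between additive functors. -/
def Adjunction.mapHomotopyCategoryPlus (adj : G ⊣ F) :
    G.mapHomotopyCategoryPlus ⊣ F.mapHomotopyCategoryPlus :=
  adj.mapHomotopyCategory.restrictFullyFaithful
    (HomotopyCategory.Plus.fullyFaithfulι C) (HomotopyCategory.Plus.fullyFaithfulι D)
    (Iso.refl _) (Iso.refl _)

end HomotopyCategory

section DerivedCategory

variable {C : Type u₁} [Category.{v₁} C] [Abelian C] [HasDerivedCategory.{w₁} C]
  {D : Type u₂} [Category.{v₂} D] [Abelian D] [HasDerivedCategory.{w₂} D]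

/-- The functor `D⁺(C) ⥤ D⁺(D)` induced by an exact functor `G : C ⥤ D`. -/
def Functor.mapDerivedCategoryPlus (G : C ⥤ D) [G.Additive] [PreservesFiniteLimits G]
    [PreservesFiniteColimits G] : DerivedCategory.Plus C ⥤ DerivedCategory.Plus D :=
  (DerivedCategory.TStructure.t (C := D)).plus.lift
    (DerivedCategory.Plus.ι ⋙ G.mapDerivedCategory) (by
      rintro ⟨X, n, ⟨K, e, hK⟩⟩
      refine ⟨n, ⟨(G.mapHomologicalComplex _).obj K,
        G.mapDerivedCategory.mapIso e ≪≫ G.mapDerivedCategoryFactors.app K, ?_⟩⟩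
      infer_instance)

/-- The functor `G.mapDerivedCategoryPlus` is given by the degreewise application of `G`
to bounded below complexes. -/
def Functor.mapDerivedCategoryPlusFactorsh (G : C ⥤ D) [G.Additive] [PreservesFiniteLimits G]
    [PreservesFiniteColimits G] :
    DerivedCategory.Plus.Qh ⋙ G.mapDerivedCategoryPlus ≅
      G.mapHomotopyCategoryPlus ⋙ DerivedCategory.Plus.Qh :=
  ((DerivedCategory.TStructure.t (C := D)).plus.fullyFaithfulι.whiskeringRight _).preimageIso
    (Functor.isoWhiskerLeft (HomotopyCategory.Plus.ι C) G.mapDerivedCategoryFactorsh)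

/-- Let `adj : G ⊣ F` be an adjunction with `G : C ⥤ D` exact, and assume that `D` has enough
injectives. This is the induced adjunction `G ⊣ RF` between bounded below derived categories. -/
def Adjunction.derivedPlus {G : C ⥤ D} {F : D ⥤ C} [G.Additive] [F.Additive]
    [PreservesFiniteLimits G] [PreservesFiniteColimits G] [EnoughInjectives D] (adj : G ⊣ F) :
    G.mapDerivedCategoryPlus ⊣ F.rightDerivedFunctorPlus :=
  haveI : G.mapDerivedCategoryPlus.IsLeftDerivedFunctor G.mapDerivedCategoryPlusFactorsh.hom
      (HomotopyCategory.Plus.quasiIso C) :=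
    Functor.isLeftDerivedFunctor_of_inverts _ _ _
  haveI : (G.mapDerivedCategoryPlus ⋙ F.rightDerivedFunctorPlus).IsLeftDerivedFunctor
      ((Functor.associator _ _ _).inv ≫ Functor.whiskerRight G.mapDerivedCategoryPlusFactorsh.hom
        F.rightDerivedFunctorPlus) (HomotopyCategory.Plus.quasiIso C) :=
    Functor.isLeftDerivedFunctor_of_inverts _ _
      ((Functor.associator _ _ _).symm ≪≫ Functor.isoWhiskerRight G.mapDerivedCategoryPlusFactorsh
        F.rightDerivedFunctorPlus)
  haveI : (F.rightDerivedFunctorPlus ⋙ G.mapDerivedCategoryPlus).IsRightDerivedFunctor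
      (Functor.whiskerRight F.rightDerivedFunctorPlusUnit G.mapDerivedCategoryPlus ≫
        (Functor.associator _ _ _).hom) (HomotopyCategory.Plus.quasiIso D) :=
    (HomotopyCategory.Plus.localizerMorphism_derives _).isRightDerivedFunctor_of_isIso _
      (fun K => by
        dsimp
        infer_instance)
  adj.mapHomotopyCategoryPlus.derived (HomotopyCategory.Plus.quasiIso C)
    (HomotopyCategory.Plus.quasiIso D) G.mapDerivedCategoryPlusFactorsh.hom
    F.rightDerivedFunctorPlusUnit

end DerivedCategory

end CategoryTheory

/-- The inclusion of the bounded derived category in the bounded below derived category. -/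
abbrev DerivedCategory.boundedToPlus (C : Type u₁) [Category.{v₁} C] [Abelian C]
    [HasDerivedCategory.{w} C] : DerivedCategory.Bounded C ⥤ DerivedCategory.Plus C :=
  ObjectProperty.ιOfLE (fun _ h => h.1)

/-! ### Stratified spaces -/

/-- A topological manifold: a Hausdorff second countable space which is locally homeomorphic
to some `ℝⁿ`. -/
def IsTopologicalManifold (M : Type u) [TopologicalSpace M] : Prop :=
  T2Space M ∧ SecondCountableTopology M ∧
    ∃ n : ℕ, Nonempty (ChartedSpace (EuclideanSpace ℝ (Fin n)) M)

/-- A (finite) stratification of a topological space: a finite partition into locally closed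
subsets which are simply connected topological manifolds, such that the closure of any
stratum is a union of strata. -/
structure Stratification (X : TopCat.{u}) where
  /-- the set of strata -/
  strata : Set (Set X)
  finite : strata.Finite
  isPartition : Setoid.IsPartition strata
  isTopologicalManifold : ∀ A ∈ strata, IsTopologicalManifold A
  simplyConnected : ∀ A ∈ strata, SimplyConnectedSpace A
  isLocallyClosed : ∀ A ∈ strata, IsLocallyClosed A
  closure_eq : ∀ A ∈ strata, ∃ T ⊆ strata, closure A = ⋃₀ T

namespace Stratification

variable {X : TopCat.{u}} (S : Stratification X)

/-- The type of strata. -/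
def Stratum : Type u := {A : Set X // A ∈ S.strata}

/-- The map which sends a point to the stratum that contains it. -/
def toStratum (x : X) : S.Stratum :=
  ⟨(S.isPartition.2 x).choose, (S.isPartition.2 x).choose_spec.1.1⟩

lemma mem_toStratum (x : X) : x ∈ (S.toStratum x).1 :=
  (S.isPartition.2 x).choose_spec.1.2

lemma eq_of_mem {A B : Set X} (hA : A ∈ S.strata) (hB : B ∈ S.strata) {x : X}
    (hxA : x ∈ A) (hxB : x ∈ B) : A = B :=
  (S.isPartition.2 x).unique ⟨hA, hxA⟩ ⟨hB, hxB⟩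

/-- The set of strata is endowed with the final topology for the projection `X → S`. -/
instance : TopologicalSpace S.Stratum := TopologicalSpace.coinduced S.toStratum inferInstance

/-- The space of strata. -/
abbrev space : TopCat.{u} := TopCat.of S.Stratum

/-- The projection `p : X ⟶ S`. -/
def proj : X ⟶ S.space := TopCat.ofHom ⟨S.toStratum, continuous_coinduced_rng⟩

/-- The inclusion of a stratum. -/
def incl (A : S.Stratum) : TopCat.of A.1 ⟶ X := TopCat.ofHom ⟨Subtype.val, continuous_subtype_val⟩

lemma subset_closure_of_mem {A B : Set X} (hA : A ∈ S.strata) (hB : B ∈ S.strata) {x : X}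
    (hxA : x ∈ A) (hx : x ∈ closure B) : A ⊆ closure B := by
  obtain ⟨T, hT, h⟩ := S.closure_eq B hB
  rw [h] at hx ⊢
  obtain ⟨A', hA', hxA'⟩ := hx
  obtain rfl := S.eq_of_mem hA (hT hA') hxA hxA'
  exact Set.subset_sUnion_of_mem hA'

/-- The star of a stratum `A`: the union of all strata whose closure contains `A`. -/
def star (A : S.Stratum) : Opens X where
  carrier := ⋃₀ {B | B ∈ S.strata ∧ A.1 ⊆ closure B}
  is_open' := by
    rw [← isClosed_compl_iff]
    have : (⋃₀ {B | B ∈ S.strata ∧ A.1 ⊆ closure B})ᶜ =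
        ⋃₀ (closure '' {B | B ∈ S.strata ∧ ¬ A.1 ⊆ closure B}) := by
      ext x
      constructor
      · intro hx
        refine ⟨_, ⟨(S.toStratum x).1, ⟨(S.toStratum x).2, fun h => hx ?_⟩, rfl⟩,
          subset_closure (S.mem_toStratum x)⟩
        exact ⟨_, ⟨(S.toStratum x).2, h⟩, S.mem_toStratum x⟩
      · rintro ⟨_, ⟨B, ⟨hB, hAB⟩, rfl⟩, hx⟩ ⟨B', ⟨hB', hAB'⟩, hx'⟩
        exact hAB (hAB'.trans (closure_minimal (S.subset_closure_of_mem hB' hB hx' hx)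
          isClosed_closure))
    rw [this, Set.sUnion_image]
    exact (S.finite.subset fun B hB => hB.1).isClosed_biUnion fun _ _ => isClosed_closure

lemma subset_star (A : S.Stratum) {x : X} (hx : x ∈ A.1) : x ∈ S.star A :=
  ⟨A.1, ⟨A.2, subset_closure⟩, hx⟩

end Stratification

/-! ### Sheaves of modules -/

/-- Sheaves of `R`-modules on `X`. -/
abbrev ModSheaf (R : Type u) [CommRing R] (X : TopCat.{u}) := TopCat.Sheaf (ModuleCat.{u} R) X

namespace ModSheaf

variable (R : Type u) [CommRing R] {X Y : TopCat.{u}}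

/-- The inverse image functor `f^*`. -/
abbrev pullback (f : X ⟶ Y) : ModSheaf R Y ⥤ ModSheaf R X :=
  TopCat.Sheaf.pullback (ModuleCat.{u} R) f

/-- The direct image functor `f_*`. -/
abbrev pushforward (f : X ⟶ Y) : ModSheaf R X ⥤ ModSheaf R Y :=
  TopCat.Sheaf.pushforward (ModuleCat.{u} R) f

/-- The adjunction `f^* ⊣ f_*`. -/
abbrev adjunction (f : X ⟶ Y) : pullback R f ⊣ pushforward R f :=
  TopCat.Sheaf.pullbackPushforwardAdjunction (ModuleCat.{u} R) f

instance (f : X ⟶ Y) : (pushforward R f).Additive where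

instance (f : X ⟶ Y) : (pullback R f).Additive := (adjunction R f).left_adjoint_additive

instance (f : X ⟶ Y) : PreservesFiniteLimits (pullback R f) :=
  Functor.SmallCategories.instPreservesFiniteLimitsSheafSheafPullbackOfRepresentablyFlat
    (Opens.map f) (ModuleCat.{u} R) (Opens.grothendieckTopology Y) (Opens.grothendieckTopology X)

instance (f : X ⟶ Y) : PreservesFiniteColimits (pullback R f) :=
  have := (adjunction R f).leftAdjoint_preservesColimits
  inferInstance

/-- The functor `Γ(U, -)`. -/
def sections (U : Opens X) : ModSheaf R X ⥤ ModuleCat.{u} R :=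
  TopCat.Sheaf.forget _ X ⋙ (evaluation _ _).obj (op U)

instance (U : Opens X) : (sections R U).Additive where

variable {R}

/-- The sheaf cohomology `Hⁱ(U, F)` of an open subset, as the `i`th right derived functor
of `Γ(U, -)`. -/
def cohomology (F : ModSheaf R X) (U : Opens X) (i : ℕ) : ModuleCat.{u} R :=
  ((sections R U).rightDerived i).obj F

/-- A sheaf is constant if it is isomorphic to the constant sheaf attached to some module. -/
def IsConstant (F : ModSheaf R X) : Prop :=
  CategoryTheory.Sheaf.IsConstant (Opens.grothendieckTopology X) F

end ModSheaf

/-! ### Weakly constructible sheaves and acyclic stratifications -/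

namespace Stratification

variable {X : TopCat.{u}} (S : Stratification X) (R : Type u) [CommRing R]

/-- A sheaf is weakly constructible if its restriction to every stratum is constant. -/
def weaklyConstructible : ObjectProperty (ModSheaf R X) := fun F =>
  ∀ A : S.Stratum, ((ModSheaf.pullback R (S.incl A)).obj F).IsConstant

/-- A sheaf `F` is `S`-acyclic if `Hⁱ(star A, F) = 0` for every stratum `A` and every `i > 0`. -/
def IsAcyclicSheaf (F : ModSheaf R X) : Prop :=
  ∀ (A : S.Stratum) (i : ℕ), 0 < i → IsZero (F.cohomology (S.star A) i)

/-- Acyclic stratifications (with respect to the base ring `R`). -/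
structure IsAcyclic : Prop where
  isIso_germ : ∀ F : ModSheaf R X, S.weaklyConstructible R F →
    ∀ (A : S.Stratum) (x : X) (hx : x ∈ A.1),
      IsIso (F.presheaf.germ (S.star A) x (S.subset_star A hx))
  isAcyclicSheaf : ∀ F : ModSheaf R X, S.weaklyConstructible R F → S.IsAcyclicSheaf R F

section

variable [HasDerivedCategory.{w₁} (ModSheaf R X)]

/-- The property of objects of `D⁺(X)` defining `D⁺_{w,c}(X)`: all the cohomology sheaves are
weakly constructible. -/
def weaklyConstructiblePlus : ObjectProperty (DerivedCategory.Plus (ModSheaf R X)) := fun K =>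
  ∀ n : ℤ, S.weaklyConstructible R ((DerivedCategory.homologyFunctor (ModSheaf R X) n).obj K.obj)

/-- The property of objects of `Dᵇ(X)` defining `Dᵇ_{w,c}(X)`: all the cohomology sheaves are
weakly constructible. -/
def weaklyConstructibleBounded : ObjectProperty (DerivedCategory.Bounded (ModSheaf R X)) :=
  fun K =>
    ∀ n : ℤ, S.weaklyConstructible R ((DerivedCategory.homologyFunctor (ModSheaf R X) n).obj K.obj)

variable [HasDerivedCategory.{w₂} (ModSheaf R S.space)]

/-- The functor `p^* : D⁺(S) ⥤ D⁺(X)`. -/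
abbrev pullbackPlus :
    DerivedCategory.Plus (ModSheaf R S.space) ⥤ DerivedCategory.Plus (ModSheaf R X) :=
  (ModSheaf.pullback R S.proj).mapDerivedCategoryPlus

/-- The functor `Rp_* : D⁺(X) ⥤ D⁺(S)`. -/
abbrev derivedPushforwardPlus :
    DerivedCategory.Plus (ModSheaf R X) ⥤ DerivedCategory.Plus (ModSheaf R S.space) :=
  (ModSheaf.pushforward R S.proj).rightDerivedFunctorPlus

/-- The adjunction `p^* ⊣ Rp_*` between `D⁺(S)` and `D⁺(X)`, induced by `p^* ⊣ p_*`. -/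
abbrev derivedAdjunction : S.pullbackPlus R ⊣ S.derivedPushforwardPlus R :=
  (ModSheaf.adjunction R S.proj).derivedPlus

end

end Stratification

end

/-! Everything rests on the stalks of `p_*`. The strata whose closure contains `A` form the smallest
open neighbourhood of `A` in `𝒮`, and its preimage is `St(A)`; hence `(p_* F)_A = Γ(St(A), F)`, and
on stalks the counit `p^* p_* F ⟶ F` is the germ map `Γ(St(A), F) ⟶ F_x`. Condition (1) makes it an
isomorphism for weakly constructible `F` (`isIso_counit_app`). Every `p^* G` is weakly
constructible, so the triangle identity makes `p^*` of the unit invertible, and so is the unit,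
since `p` is surjective.

To derive this, condition (2) is used through the class of sheaves without higher cohomology on
stars, which is adapted to `p_*` (`starAcyclic_isAdaptedTo`). The terms of `p^* K` lie in this
class, so `Rp_* p^* K` is computed termwise and the derived unit is the termwise unit. For the
counit, represent `L` in `D^+_{w,c}(X)` by a bounded below complex `I` of injectives. Terms and
cohomology of `I` are adapted, so `p_*` commutes with the cohomology of `I`, and the counit induces
on `Hⁿ` the map `p^* p_* Hⁿ(I) ⟶ Hⁿ(I)`, an isomorphism.

In the bounded case `Rp_* L` is bounded because `p^* Rp_* L ≅ L` and the exact, conservative functor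
`p^*` detects vanishing of cohomology; no bound on the homological dimension enters. -/

noncomputable section

/-! ### Left exact functors and adapted classes of objects. -/

namespace CategoryTheory

/-- A class of objects that is adapted to a left exact functor `T`: it contains the injective
objects, it is closed under extensions and under quotients by its own members, and `T` is exact
on short exact sequences whose first term belongs to the class. -/
structure ObjectProperty.IsAdaptedTo {C : Type u₁} [Category.{v₁} C] [Abelian C]
    {D : Type u₂} [Category.{v₂} D] [Abelian D] (P : ObjectProperty C) (T : C ⥤ D) : Prop where
  of_injective (I : C) [Injective I] : P I
  ext {S : ShortComplex C} (hS : S.ShortExact) (h₁ : P S.X₁) (h₃ : P S.X₃) : P S.X₂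
  quotient {S : ShortComplex C} (hS : S.ShortExact) (h₁ : P S.X₁) (h₂ : P S.X₂) : P S.X₃
  epi_map {S : ShortComplex C} (hS : S.ShortExact) (h₁ : P S.X₁) : Epi (T.map S.g)

namespace ObjectProperty.IsAdaptedTo

variable {C : Type u₁} [Category.{v₁} C] [Abelian C] {D : Type u₂} [Category.{v₂} D] [Abelian D]
  {E : Type u₃} [Category.{v₃} E] [Abelian E]
  {P : ObjectProperty C} {T : C ⥤ D}

lemma comp (hP : P.IsAdaptedTo T) (G : D ⥤ E) [G.PreservesEpimorphisms] :
    P.IsAdaptedTo (T ⋙ G) where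
  of_injective := hP.of_injective
  ext := hP.ext
  quotient := hP.quotient
  epi_map hS h₁ := by
    have := hP.epi_map hS h₁
    dsimp
    infer_instance

lemma of_isZero (hP : P.IsAdaptedTo T) {X : C} (hX : IsZero X) : P X :=
  have := hX.injective
  hP.of_injective X

-- An isomorphism exhibits its target as an extension of `0` by its source.
open ZeroObject in
lemma of_iso (hP : P.IsAdaptedTo T) {X Y : C} (e : X ≅ Y) (hX : P X) : P Y := by
  let S : ShortComplex C := ShortComplex.mk e.hom (0 : Y ⟶ 0) (by simp)
  have hS : S.ShortExact :=
    { exact := (S.exact_iff_epi rfl).2 (by dsimp [S]; infer_instance)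
      mono_f := by dsimp [S]; infer_instance
      epi_g := by dsimp [S]; infer_instance }
  exact hP.ext hS hX (hP.of_isZero (isZero_zero C))

lemma biprod (hP : P.IsAdaptedTo T) {X Y : C} (hX : P X) (hY : P Y) : P (X ⊞ Y) :=
  hP.ext (S := ShortComplex.mk (biprod.inl : X ⟶ X ⊞ Y) biprod.snd (by simp))
    (ShortComplex.Splitting.shortExact
      { r := biprod.fst
        s := biprod.inr }) hX hY

end ObjectProperty.IsAdaptedTo

section

variable {C : Type u₁} [Category.{v₁} C] [Abelian C] {D : Type u₂} [Category.{v₂} D] [Abelian D]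
  {P : ObjectProperty C} {T : C ⥤ D}

/-- If `f = e ≫ i` with `e` epi, `i` mono, a left exact functor which preserves the epimorphism
`e` and the cokernel projection of `i` preserves the cokernel of `f`. -/
lemma preservesColimit_parallelPair_of_epi [T.Additive] [PreservesFiniteLimits T]
    {X B Z H : C} (f : X ⟶ Z) (e : X ⟶ B) (i : B ⟶ Z) (fac : e ≫ i = f) (p : Z ⟶ H)
    (w : i ≫ p = 0) (hip : (ShortComplex.mk i p w).ShortExact) [Epi e]
    [Epi (T.map e)] [Epi (T.map p)] : PreservesColimit (parallelPair f 0) T := by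
  have := hip.mono_f
  have := hip.epi_g
  have wf : f ≫ p = 0 := by rw [← fac, Category.assoc, w, comp_zero]
  have hc : IsColimit (CokernelCofork.ofπ p wf) := by
    subst fac
    exact isCokernelEpiComp (f := i) (c := CokernelCofork.ofπ p w) hip.gIsCokernel e rfl
  refine preservesColimit_of_preserves_colimit_cocone hc ?_
  -- Left exactness makes `T i` the kernel of the epimorphism `T p`, so `T p` is the cokernel of `T
  -- i`; precomposing with the epimorphism `T e` leaves the cokernel unchanged.
  have w' : T.map i ≫ T.map p = 0 := by rw [← T.map_comp, w, T.map_zero]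
  have hk : IsLimit (KernelFork.ofι (T.map i) w') :=
    KernelFork.mapIsLimit (KernelFork.ofι i w) hip.fIsKernel T
  have hex : (ShortComplex.mk _ _ w').ShortExact :=
    { exact := ShortComplex.exact_of_f_is_kernel _ hk
      mono_f := by dsimp; infer_instance
      epi_g := by dsimp; infer_instance }
  refine (CokernelCofork.isColimitMapCoconeEquiv (CokernelCofork.ofπ p wf) T).symm ?_
  exact isCokernelEpiComp (f := T.map i) (c := CokernelCofork.ofπ (T.map p) w')
    hex.gIsCokernel (T.map e) (by rw [← T.map_comp, fac])

open HomologicalComplex in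
/-- In a bounded below complex whose terms and cohomology objects belong to a class adapted to
`T`, the functor `T` preserves the left homology in every degree. -/
lemma ObjectProperty.IsAdaptedTo.preservesLeftHomologyOf_sc [T.Additive] [PreservesFiniteLimits T]
    (hP : P.IsAdaptedTo T) (K : CochainComplex C ℤ) (n : ℤ) [K.IsStrictlyGE n]
    (hX : ∀ i, P (K.X i)) (hH : ∀ i, P (K.homology i)) (i : ℤ) :
    T.PreservesLeftHomologyOf (K.sc i) := by
  let e (i j : ℤ) := factorThruImage (K.toCycles i j)
  let m (i j : ℤ) := image.ι (K.toCycles i j)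
  have fac (i j : ℤ) : e i j ≫ m i j = K.toCycles i j := image.fac _
  have we (i j : ℤ) : K.iCycles i ≫ e i j = 0 := by
    rw [← cancel_mono (m i j), Category.assoc, fac, ← cancel_mono (K.iCycles j)]
    simp
  have wm (i j : ℤ) : m i j ≫ K.homologyπ j = 0 := by
    rw [← cancel_epi (e i j), ← Category.assoc, fac]
    simp
  -- `0 ⟶ Zⁱ ⟶ Kⁱ ⟶ Bʲ ⟶ 0`, where `Bʲ` is the image of `K.toCycles i j`.
  have hS₁ (i j : ℤ) (hij : i + 1 = j) : (ShortComplex.mk _ _ (we i j)).ShortExact :=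
    { exact := by
        refine ShortComplex.exact_of_f_is_kernel _ (KernelFork.IsLimit.ofι' _ _ fun {A} k hk ↦ ?_)
        have hk' : k ≫ K.d i j = 0 := by
          have hk₀ : k ≫ e i j = 0 := hk
          have := congrArg (fun f ↦ f ≫ m i j ≫ K.iCycles j) hk₀
          simpa [reassoc_of% fac i j] using this
        exact ⟨K.liftCycles k j (by simpa using hij) hk', by simp⟩
      mono_f := by dsimp; infer_instance
      epi_g := by dsimp [e]; infer_instance }
  -- `0 ⟶ Bʲ ⟶ Zʲ ⟶ Hʲ ⟶ 0`.
  have hS₂ (i j : ℤ) (hij : i + 1 = j) : (ShortComplex.mk _ _ (wm i j)).ShortExact :=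
    { exact := by
        refine ShortComplex.exact_of_g_is_cokernel _ (CokernelCofork.IsColimit.ofπ' _ _
          fun {A} k hk ↦ ?_)
        have hk' : K.toCycles i j ≫ k = 0 := by
          dsimp at hk
          rw [← fac, Category.assoc, hk, comp_zero]
        have hc := K.homologyIsCokernel i j (by simp; lia)
        exact ⟨hc.desc (CokernelCofork.ofπ k hk'), hc.fac _ WalkingParallelPair.one⟩
      mono_f := by dsimp; infer_instance
      epi_g := by dsimp; infer_instance }
  -- Upward induction from degree `n - 1`, at and below which the cycles vanish: `Bʲ` is the
  -- quotient of `Kʲ⁻¹` by `Zʲ⁻¹`, and `Zʲ` is an extension of `Hʲ` by `Bʲ`.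
  have hZ (j : ℤ) (k : ℕ) (hk : j ≤ n - 1 + k) : P (K.cycles j) := by
    induction k generalizing j with
    | zero =>
      exact hP.of_isZero (IsZero.of_mono (K.iCycles j) (K.isZero_of_isStrictlyGE n j (by
        simp at hk; lia)))
    | succ k ih =>
      exact hP.ext (hS₂ (j - 1) j (by simp)) (hP.quotient (hS₁ (j - 1) j (by simp))
        (ih _ (by push_cast at hk; lia)) (hX _)) (hH _)
  replace hZ (i : ℤ) : P (K.cycles i) := hZ i (i - n + 1).toNat (by lia)
  let j := (ComplexShape.up ℤ).prev i
  have hj : j + 1 = i := by simp [j]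
  have h₁ : Epi (T.map (e j i)) := hP.epi_map (hS₁ j i hj) (hZ j)
  have h₂ : Epi (T.map (K.homologyπ i)) :=
    hP.epi_map (hS₂ j i hj) (hP.quotient (hS₁ j i hj) (hZ j) (hX j))
  have he : Epi (e j i) := by dsimp [e]; infer_instance
  have hf' : K.toCycles j i = (K.sc i).leftHomologyData.f' :=
    (cancel_mono (K.iCycles i)).1 ((K.toCycles_i j i).trans
      (K.sc i).leftHomologyData.f'_i.symm)
  have h₃ : PreservesColimit (parallelPair (K.toCycles j i) 0) T :=
    preservesColimit_parallelPair_of_epi _ (e j i) (m j i) (fac j i) _ (wm j i) (hS₂ j i hj)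
  have h₄ : (K.sc i).leftHomologyData.IsPreservedBy T :=
    { g := inferInstance
      f' := hf' ▸ h₃ }
  exact .mk' _ (K.sc i).leftHomologyData

/-- A left exact functor maps bounded below acyclic complexes with terms in an adapted class to
acyclic complexes. -/
lemma ObjectProperty.IsAdaptedTo.acyclic_map [T.Additive] [PreservesFiniteLimits T]
    (hP : P.IsAdaptedTo T) (K : CochainComplex C ℤ) (n : ℤ) [K.IsStrictlyGE n]
    (hX : ∀ i, P (K.X i)) (hK : K.Acyclic) :
    ((T.mapHomologicalComplex (ComplexShape.up ℤ)).obj K).Acyclic := by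
  intro i
  have hH (i : ℤ) : IsZero (K.homology i) := (hK i).isZero_homology
  have := hP.preservesLeftHomologyOf_sc K n hX (fun i ↦ hP.of_isZero (hH i)) i
  rw [HomologicalComplex.exactAt_iff_isZero_homology]
  exact (T.map_isZero (hH i)).of_iso ((K.sc i).mapHomologyIso T)

/-- If the terms and the cohomology objects of a bounded below complex `K` belong to a class
adapted to `T`, then a natural transformation `T ⟶ T'` to an exact functor that is an isomorphism
on the cohomology objects of `K` induces a quasi-isomorphism on `K`. -/
lemma ObjectProperty.IsAdaptedTo.quasiIso_mapHomologicalComplex [T.Additive]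
    [PreservesFiniteLimits T]
    (hP : P.IsAdaptedTo T) (K : CochainComplex C ℤ) (n : ℤ) [K.IsStrictlyGE n]
    (hX : ∀ i, P (K.X i)) (hH : ∀ i, P (K.homology i)) {T' : C ⥤ D} [T'.Additive]
    [T'.PreservesHomology] (τ : T ⟶ T') (hτ : ∀ i, IsIso (τ.app (K.homology i))) :
    QuasiIso ((NatTrans.mapHomologicalComplex τ (ComplexShape.up ℤ)).app K) := by
  refine ⟨fun i ↦ ?_⟩
  have := hP.preservesLeftHomologyOf_sc K n hX hH i
  rw [quasiIsoAt_iff_isIso_homologyMap]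
  -- Both functors preserve the left homology data, so the map on homology is `τ.app` of the
  -- homology object, up to the comparison isomorphisms.
  have h := (ShortComplex.LeftHomologyMapData.natTransApp
    (K.sc i).homologyData.left τ).homologyMap_eq
  have : IsIso (τ.app (K.sc i).homologyData.left.H) := by
    rw [← NatTrans.isIso_app_iff_of_iso τ (K.sc i).homologyData.left.homologyIso]
    exact hτ i
  change IsIso (ShortComplex.homologyMap ((K.sc i).mapNatTrans τ))
  rw [h]
  let e : T.obj (K.sc i).homologyData.left.H ≅ T'.obj (K.sc i).homologyData.left.H :=
    asIso (τ.app (K.sc i).homologyData.left.H)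
  exact (((K.sc i).homologyData.left.map T).homologyIso ≪≫ e ≪≫
      ((K.sc i).homologyData.left.map T').homologyIso.symm).isIso_hom

/-- A left exact functor preserves quasi-isomorphisms between bounded below complexes with terms in an
adapted class. -/
lemma ObjectProperty.IsAdaptedTo.quasiIso_map [T.Additive] [PreservesFiniteLimits T]
    (hP : P.IsAdaptedTo T) {K L : HomotopyCategory.Plus C} (f : K ⟶ L)
    (hK : ∀ i, P (K.obj.as.X i)) (hL : ∀ i, P (L.obj.as.X i))
    (hf : HomotopyCategory.Plus.quasiIso C f) :
    HomotopyCategory.Plus.quasiIso D (T.mapHomotopyCategoryPlus.map f) := by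
  rw [HomotopyCategory.Plus.quasiIso_iff] at hf ⊢
  obtain ⟨K, hK'⟩ := K
  obtain ⟨L, hL'⟩ := L
  obtain ⟨K : CochainComplex C ℤ, rfl⟩ := HomotopyCategory.quotient_obj_surjective K
  obtain ⟨L : CochainComplex C ℤ, rfl⟩ := HomotopyCategory.quotient_obj_surjective L
  obtain ⟨f, rfl⟩ := ObjectProperty.homMk_surjective f
  obtain ⟨f : K ⟶ L, rfl⟩ := (HomotopyCategory.quotient _ _).map_surjective f
  obtain ⟨a, _⟩ := (HomotopyCategory.plus_quotient_obj_iff _).1 hK'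
  obtain ⟨b, _⟩ := (HomotopyCategory.plus_quotient_obj_iff _).1 hL'
  -- A map is a quasi-isomorphism exactly when its cone is acyclic. The cone has terms `Kⁱ⁺¹ ⊞ Lⁱ`,
  -- which explains the lower bound `min (a - 1) b` below.
  have mem := HomotopyCategory.mappingCone_triangleh_distinguished f
  have mem' := (T.mapHomotopyCategory (ComplexShape.up ℤ)).map_distinguished _ mem
  rw [HomotopyCategory.quasiIso_eq_trW_subcategoryAcyclic] at hf ⊢
  replace hf := ((HomotopyCategory.subcategoryAcyclic C).trW_iff_of_distinguished _ mem).1 hf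
  refine ((HomotopyCategory.subcategoryAcyclic D).trW_iff_of_distinguished _ mem').2 ?_
  have := CochainComplex.isStrictlyGE_mappingCone f a b (min (a - 1) b) (by simp) (by simp)
  refine (HomotopyCategory.quotient_obj_mem_subcategoryAcyclic_iff_acyclic _).2
    (hP.acyclic_map (CochainComplex.mappingCone f) (min (a - 1) b) (fun i ↦ ?_)
      ((HomotopyCategory.quotient_obj_mem_subcategoryAcyclic_iff_acyclic _).1 hf))
  exact hP.of_iso (HomologicalComplex.homotopyCofiber.XIsoBiprod f i (i + 1) rfl).symm
    (hP.biprod (hK _) (hL _))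

/-- The unit of the right derived functor is an isomorphism on bounded below complexes with
terms in an adapted class. -/
lemma ObjectProperty.IsAdaptedTo.isIso_rightDerivedFunctorPlusUnit_app [T.Additive]
    [PreservesFiniteLimits T] [EnoughInjectives C]
    [HasDerivedCategory.{w₁} C] [HasDerivedCategory.{w₂} D]
    (hP : P.IsAdaptedTo T) (K : HomotopyCategory.Plus C) (hX : ∀ i, P (K.obj.as.X i)) :
    IsIso (T.rightDerivedFunctorPlusUnit.app K) := by
  -- Compare `K` with an injective resolution `r.w`: the unit is invertible on the resolution, and
  -- both other sides of the naturality square for `r.w` are invertible.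
  let r : (HomotopyCategory.Plus.localizerMorphism C).RightResolution K := Classical.arbitrary _
  let I := (HomotopyCategory.Plus.localizerMorphism C).functor.obj r.X₁
  have h₁ : IsIso (T.rightDerivedFunctorPlusUnit.app I) := by
    dsimp [I]
    infer_instance
  have h₂ : IsIso (DerivedCategory.Plus.Qh.map r.w) :=
    Localization.inverts _ (HomotopyCategory.Plus.quasiIso C) _ r.hw
  have h₃ : IsIso (DerivedCategory.Plus.Qh.map (T.mapHomotopyCategoryPlus.map r.w)) := by
    refine Localization.inverts _ (HomotopyCategory.Plus.quasiIso D) _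
      (hP.quasiIso_map _ hX (fun i ↦ ?_) r.hw)
    have : Injective (I.obj.as.X i) := (r.X₁.obj.as.X i).property
    exact hP.of_injective _
  have := T.rightDerivedFunctorPlusUnit.naturality r.w
  dsimp at this
  have h₄ : IsIso (T.rightDerivedFunctorPlusUnit.app K ≫
      T.rightDerivedFunctorPlus.map (DerivedCategory.Plus.Qh.map r.w)) := by
    rw [← this]
    infer_instance
  exact IsIso.of_isIso_comp_right _
    (T.rightDerivedFunctorPlus.map (DerivedCategory.Plus.Qh.map r.w))

end

end CategoryTheory

/-! ### Unit and counit of a derived adjunction. -/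

namespace CategoryTheory

/-- An adjunction whose functors restrict to full subcategories induces an equivalence between
them if the unit and the counit are isomorphisms on these subcategories. -/
lemma Adjunction.inducesEquivalence {C : Type u₁} [Category.{v₁} C] {D : Type u₂} [Category.{v₂} D]
    {C' : Type u₃} [Category.{v₃} C'] {D' : Type u₄} [Category.{v₄} D']
    {G : C ⥤ D} {F : D ⥤ C} (adj : G ⊣ F) {iC : C' ⥤ C} {iD : D' ⥤ D}
    (hC : iC.FullyFaithful) (hD : iD.FullyFaithful) {G' : C' ⥤ D'} {F' : D' ⥤ C'}
    (α : G' ⋙ iD ≅ iC ⋙ G) (β : F' ⋙ iC ≅ iD ⋙ F)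
    (hunit : ∀ X : C', IsIso (adj.unit.app (iC.obj X)))
    (hcounit : ∀ Y : D', IsIso (adj.counit.app (iD.obj Y))) :
    adj.InducesEquivalence iC iD := by
  let adj' : G' ⊣ F' := adj.restrictFullyFaithful hC hD α.symm β.symm
  have h₁ (X : C') : iC.map (adj'.unit.app X) =
      adj.unit.app (iC.obj X) ≫ F.map (α.inv.app X) ≫ β.inv.app (G'.obj X) :=
    map_restrictFullyFaithful_unit_app ..
  have h₂ (Y : D') : iD.map (adj'.counit.app Y) =
      α.hom.app (F'.obj Y) ≫ G.map (β.hom.app Y) ≫ adj.counit.app (iD.obj Y) :=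
    map_restrictFullyFaithful_counit_app ..
  have (X : C') : IsIso (adj'.unit.app X) := by
    have : IsIso (iC.map (adj'.unit.app X)) := by
      rw [h₁]
      infer_instance
    have := hC.reflectsIsomorphisms
    exact isIso_of_reflects_iso _ iC
  have (Y : D') : IsIso (adj'.counit.app Y) := by
    have : IsIso (iD.map (adj'.counit.app Y)) := by
      rw [h₂]
      infer_instance
    have := hD.reflectsIsomorphisms
    exact isIso_of_reflects_iso _ iD
  refine ⟨adj'.toEquivalence.symm, α, β, fun X ↦ ?_, fun Y ↦ ?_⟩
  · change iC.map (adj'.unit.app X) ≫ β.hom.app (G'.obj X) = _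
    simp [h₁]
    rfl
  · change G.map (β.inv.app Y) ≫ α.inv.app (F'.obj Y) ≫ iD.map (adj'.counit.app Y) = _
    rw [h₂, Iso.inv_hom_id_app_assoc, ← G.map_comp_assoc, Iso.inv_hom_id_app]
    simp

section HomotopyCategory

variable {C : Type u₁} [Category.{v₁} C] [Preadditive C]
  {D : Type u₂} [Category.{v₂} D] [Preadditive D]
  {G : C ⥤ D} {F : D ⥤ C} [G.Additive] [F.Additive] (adj : G ⊣ F)

lemma Adjunction.mapHomotopyCategoryPlus_unit_app_hom (K : HomotopyCategory.Plus C) :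
    (adj.mapHomotopyCategoryPlus.unit.app K).hom =
      (HomotopyCategory.quotient C _).map (adj.mapCochainComplex.unit.app K.obj.as) := by
  refine (map_restrictFullyFaithful_unit_app adj.mapHomotopyCategory
    (HomotopyCategory.Plus.fullyFaithfulι C) (HomotopyCategory.Plus.fullyFaithfulι D)
    (L := G.mapHomotopyCategoryPlus) (R := F.mapHomotopyCategoryPlus)
    (Iso.refl _) (Iso.refl _) K).trans ?_
  erw [Functor.map_id, Category.comp_id, Category.comp_id]
  rfl

lemma Adjunction.mapHomotopyCategoryPlus_counit_app_hom (K : HomotopyCategory.Plus D) :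
    (adj.mapHomotopyCategoryPlus.counit.app K).hom =
      (HomotopyCategory.quotient D _).map (adj.mapCochainComplex.counit.app K.obj.as) := by
  refine (map_restrictFullyFaithful_counit_app adj.mapHomotopyCategory
    (HomotopyCategory.Plus.fullyFaithfulι C) (HomotopyCategory.Plus.fullyFaithfulι D)
    (L := G.mapHomotopyCategoryPlus) (R := F.mapHomotopyCategoryPlus)
    (Iso.refl _) (Iso.refl _) K).trans ?_
  erw [Functor.map_id, Category.id_comp, Category.id_comp]
  rfl

end HomotopyCategory

section DerivedCategory

variable {C : Type u₁} [Category.{v₁} C] [Abelian C] [HasDerivedCategory.{w₁} C]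
  {D : Type u₂} [Category.{v₂} D] [Abelian D] [HasDerivedCategory.{w₂} D]

/-- The cohomology of the image of a complex in the derived category. -/
def _root_.DerivedCategory.Plus.homologyQhObjIso (K : HomotopyCategory.Plus C) (n : ℤ) :
    (DerivedCategory.homologyFunctor C n).obj (DerivedCategory.Plus.Qh.obj K).obj ≅
      K.obj.as.homology n :=
  (DerivedCategory.homologyFunctorFactorsh C n).app K.obj ≪≫
    (HomotopyCategory.homologyFunctorFactors C (ComplexShape.up ℤ) n).app K.obj.as

/-- The exact functor `G.mapDerivedCategoryPlus` commutes with taking cohomology. -/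
lemma Functor.nonempty_homology_mapDerivedCategoryPlus_obj_iso (G : C ⥤ D) [G.Additive]
    [PreservesFiniteLimits G] [PreservesFiniteColimits G] (K : DerivedCategory.Plus C) (n : ℤ) :
    Nonempty ((DerivedCategory.homologyFunctor D n).obj (G.mapDerivedCategoryPlus.obj K).obj ≅
      G.obj ((DerivedCategory.homologyFunctor C n).obj K.obj)) := by
  let K' := DerivedCategory.Plus.Qh.objPreimage K
  let e : DerivedCategory.Plus.Qh.obj K' ≅ K := DerivedCategory.Plus.Qh.objObjPreimageIso K
  exact ⟨(DerivedCategory.Plus.ι ⋙ DerivedCategory.homologyFunctor D n).mapIso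
      (G.mapDerivedCategoryPlus.mapIso e.symm ≪≫
      G.mapDerivedCategoryPlusFactorsh.app K') ≪≫
    DerivedCategory.Plus.homologyQhObjIso _ n ≪≫
    (K'.obj.as.sc n).mapHomologyIso G ≪≫
    G.mapIso ((DerivedCategory.Plus.homologyQhObjIso K' n).symm ≪≫
      (DerivedCategory.Plus.ι ⋙ DerivedCategory.homologyFunctor C n).mapIso e)⟩

variable {G : C ⥤ D} {F : D ⥤ C} [G.Additive] [F.Additive]
    [PreservesFiniteLimits G] [PreservesFiniteColimits G] [EnoughInjectives D] (adj : G ⊣ F)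

/-- This factorization characterizes the derived unit; it reduces its invertibility to that of the
termwise unit and of the comparison from `F` to its derived functor. The local instance repeats one
from the construction of `derivedPlus`. -/
lemma Adjunction.derivedPlus_unit_app_Qh_obj (K : HomotopyCategory.Plus C) :
    adj.derivedPlus.unit.app (DerivedCategory.Plus.Qh.obj K) ≫
        F.rightDerivedFunctorPlus.map (G.mapDerivedCategoryPlusFactorsh.hom.app K) =
      DerivedCategory.Plus.Qh.map (adj.mapHomotopyCategoryPlus.unit.app K) ≫
        F.rightDerivedFunctorPlusUnit.app (G.mapHomotopyCategoryPlus.obj K) := by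
  have : (G.mapDerivedCategoryPlus ⋙ F.rightDerivedFunctorPlus).IsLeftDerivedFunctor
      ((Functor.associator _ _ _).inv ≫ Functor.whiskerRight G.mapDerivedCategoryPlusFactorsh.hom
        F.rightDerivedFunctorPlus) (HomotopyCategory.Plus.quasiIso C) :=
    Functor.isLeftDerivedFunctor_of_inverts _ _
      ((Functor.associator _ _ _).symm ≪≫ Functor.isoWhiskerRight G.mapDerivedCategoryPlusFactorsh
        F.rightDerivedFunctorPlus)
  exact adj.mapHomotopyCategoryPlus.derivedη_fac_app (HomotopyCategory.Plus.quasiIso C)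
    G.mapDerivedCategoryPlusFactorsh.hom F.rightDerivedFunctorPlusUnit K

/-- Dual factorization: on a complex where `F` computes its derived functor, the derived counit is
the termwise counit up to isomorphism. -/
lemma Adjunction.derivedPlus_counit_app_Qh_obj (K : HomotopyCategory.Plus D) :
    G.mapDerivedCategoryPlus.map (F.rightDerivedFunctorPlusUnit.app K) ≫
        adj.derivedPlus.counit.app (DerivedCategory.Plus.Qh.obj K) =
      G.mapDerivedCategoryPlusFactorsh.hom.app (F.mapHomotopyCategoryPlus.obj K) ≫
        DerivedCategory.Plus.Qh.map (adj.mapHomotopyCategoryPlus.counit.app K) := by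
  have : (F.rightDerivedFunctorPlus ⋙ G.mapDerivedCategoryPlus).IsRightDerivedFunctor
      (Functor.whiskerRight F.rightDerivedFunctorPlusUnit G.mapDerivedCategoryPlus ≫
        (Functor.associator _ _ _).hom) (HomotopyCategory.Plus.quasiIso D) :=
    (HomotopyCategory.Plus.localizerMorphism_derives _).isRightDerivedFunctor_of_isIso _
      (fun K => by
        dsimp
        infer_instance)
  exact adj.mapHomotopyCategoryPlus.derivedε_fac_app (HomotopyCategory.Plus.quasiIso D)
    G.mapDerivedCategoryPlusFactorsh.hom F.rightDerivedFunctorPlusUnit K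

variable {P : ObjectProperty D}

/-- If the values of `G` belong to a class adapted to `F` and the unit of `G ⊣ F` is an
isomorphism, then so is the unit of the derived adjunction. -/
lemma Adjunction.isIso_derivedPlus_unit_app (hP : P.IsAdaptedTo F) (hG : ∀ X, P (G.obj X))
    (hunit : ∀ X, IsIso (adj.unit.app X)) (K : DerivedCategory.Plus C) :
    IsIso (adj.derivedPlus.unit.app K) := by
  have := adj.rightAdjoint_preservesLimits
  rw [← NatTrans.isIso_app_iff_of_iso _ (DerivedCategory.Plus.Qh.objObjPreimageIso K)]
  set K' := DerivedCategory.Plus.Qh.objPreimage K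
  have h₁ : IsIso (F.rightDerivedFunctorPlusUnit.app (G.mapHomotopyCategoryPlus.obj K')) :=
    hP.isIso_rightDerivedFunctorPlusUnit_app _ (fun i ↦ hG _)
  have h₂ : IsIso (adj.mapHomotopyCategoryPlus.unit.app K') := by
    have : IsIso (adj.mapCochainComplex.unit.app K'.obj.as) := by
      have (i : ℤ) : IsIso ((adj.mapCochainComplex.unit.app K'.obj.as).f i) :=
        hunit (K'.obj.as.X i)
      exact HomologicalComplex.Hom.isIso_of_components _
    have : IsIso ((HomotopyCategory.Plus.ι C).map (adj.mapHomotopyCategoryPlus.unit.app K')) := by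
      change IsIso (adj.mapHomotopyCategoryPlus.unit.app K').hom
      rw [mapHomotopyCategoryPlus_unit_app_hom]
      exact ((HomotopyCategory.quotient C (ComplexShape.up ℤ)).mapIso
        (asIso (adj.mapCochainComplex.unit.app K'.obj.as))).isIso_hom
    exact isIso_of_reflects_iso _ (HomotopyCategory.Plus.ι C)
  have := adj.derivedPlus_unit_app_Qh_obj K'
  have h₃ : IsIso (adj.derivedPlus.unit.app (DerivedCategory.Plus.Qh.obj K') ≫
      F.rightDerivedFunctorPlus.map (G.mapDerivedCategoryPlusFactorsh.hom.app K')) := by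
    rw [this]
    infer_instance
  exact IsIso.of_isIso_comp_right _
    (F.rightDerivedFunctorPlus.map (G.mapDerivedCategoryPlusFactorsh.hom.app K'))

/-- If the cohomology objects of `L` belong to a class adapted to `F` and the counit of `G ⊣ F`
is an isomorphism on them, then the counit of the derived adjunction is an isomorphism on `L`. -/
lemma Adjunction.isIso_derivedPlus_counit_app (hP : P.IsAdaptedTo F) (L : DerivedCategory.Plus D)
    (hL : ∀ n, P ((DerivedCategory.homologyFunctor D n).obj L.obj))
    (hcounit : ∀ n, IsIso (adj.counit.app ((DerivedCategory.homologyFunctor D n).obj L.obj))) :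
    IsIso (adj.derivedPlus.counit.app L) := by
  have := adj.rightAdjoint_preservesLimits
  -- `L` is represented by a bounded below complex `I` of injectives, on which the unit of the right
  -- derived functor is invertible.
  let Φ := (InjectiveObject.ι D).mapHomotopyCategoryPlus ⋙ DerivedCategory.Plus.Qh
  let I := (InjectiveObject.ι D).mapHomotopyCategoryPlus.obj (Φ.objPreimage L)
  let e : DerivedCategory.Plus.Qh.obj I ≅ L := Φ.objObjPreimageIso L
  let eH (n : ℤ) : (DerivedCategory.homologyFunctor D n).obj L.obj ≅ I.obj.as.homology n :=
    (DerivedCategory.homologyFunctor D n).mapIso (DerivedCategory.Plus.ι.mapIso e.symm) ≪≫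
      DerivedCategory.Plus.homologyQhObjIso I n
  rw [← NatTrans.isIso_app_iff_of_iso _ e]
  have hI (i : ℤ) : Injective (I.obj.as.X i) := ((Φ.objPreimage L).obj.as.X i).property
  obtain ⟨n, _⟩ : CochainComplex.plus D I.obj.as :=
    (HomotopyCategory.plus_quotient_obj_iff I.obj.as).1 I.property
  -- Adaptedness is applied to the left exact composite `F ⋙ G`, with the counit as the
  -- transformation to the identity.
  have h₁ : QuasiIso (adj.mapCochainComplex.counit.app I.obj.as) :=
    (hP.comp G).quasiIso_mapHomologicalComplex I.obj.as n (fun i ↦ hP.of_injective _)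
      (fun i ↦ hP.of_iso (eH i) (hL i)) adj.counit (fun i ↦ by
        rw [← NatTrans.isIso_app_iff_of_iso _ (eH i)]
        exact hcounit i)
  have h₂ : IsIso (DerivedCategory.Plus.Qh.map (adj.mapHomotopyCategoryPlus.counit.app I)) := by
    refine Localization.inverts _ (HomotopyCategory.Plus.quasiIso D) _ ?_
    rw [HomotopyCategory.Plus.quasiIso_iff, mapHomotopyCategoryPlus_counit_app_hom]
    exact (HomotopyCategory.quotient_map_mem_quasiIso_iff _).2 h₁
  have := adj.derivedPlus_counit_app_Qh_obj I
  have h₃ : IsIso (G.mapDerivedCategoryPlus.map (F.rightDerivedFunctorPlusUnit.app I) ≫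
        adj.derivedPlus.counit.app (DerivedCategory.Plus.Qh.obj I)) := by
    rw [this]
    infer_instance
  exact IsIso.of_isIso_comp_left
    (G.mapDerivedCategoryPlus.map (F.rightDerivedFunctorPlusUnit.app I)) _

end DerivedCategory

end CategoryTheory

/-! ### Stalks of direct and inverse images. -/

lemma TopCat.Presheaf.stalkPushforward_naturality {C : Type u₁} [Category.{u} C] [HasColimits C]
    {X Y : TopCat.{u}} (f : X ⟶ Y) {F F' : X.Presheaf C} (φ : F ⟶ F') (x : X) :
    (stalkFunctor C (f x)).map ((pushforward C f).map φ) ≫ stalkPushforward C f F' x =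
      stalkPushforward C f F x ≫ (stalkFunctor C x).map φ := by
  refine stalk_hom_ext _ fun U hU ↦ ?_
  have h₁ := stalkFunctor_map_germ U (f x) hU ((pushforward C f).map φ)
  have h₂ := stalkFunctor_map_germ ((Opens.map f).obj U) x hU φ
  refine ((Category.assoc _ _ _).symm.trans
    (congrArg (· ≫ stalkPushforward C f F' x) h₁)).trans ?_
  refine (Category.assoc _ _ _).trans
    ((congrArg (φ.app _ ≫ ·) (stalkPushforward_germ C f F' U x hU)).trans ?_)
  exact (h₂.symm.trans (congrArg (· ≫ (stalkFunctor C x).map φ)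
    (stalkPushforward_germ C f F U x hU).symm)).trans (Category.assoc _ _ _)

/-- The germ map at the smallest open neighborhood of a point is an isomorphism. -/
lemma TopCat.Presheaf.isIso_germ_of_forall_le {C : Type u₁} [Category.{u} C] [HasColimits C]
    {X : TopCat.{u}} (F : X.Presheaf C) (x : X) (W : Opens X) (hx : x ∈ W)
    (hW : ∀ U : Opens X, x ∈ U → W ≤ U) : IsIso (F.germ W x hx) := by
  let j : (OpenNhds x)ᵒᵖ := op ⟨W, hx⟩
  have hj : IsTerminal j := IsTerminal.ofUniqueHom
    (fun U ↦ (homOfLE (hW U.unop.1 U.unop.2) : (⟨W, hx⟩ : OpenNhds x) ⟶ U.unop).op)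
    (fun _ _ ↦ Subsingleton.elim _ _)
  exact isIso_ι_of_isTerminal hj ((OpenNhds.inclusion x).op ⋙ F)

namespace ModSheaf

variable (R : Type u) [CommRing R] {X Y : TopCat.{u}}

/-- The functor that sends a sheaf of modules to its stalk at `x`. -/
def stalk (x : X) : ModSheaf R X ⥤ ModuleCat.{u} R :=
  TopCat.Sheaf.forget _ X ⋙ TopCat.Presheaf.stalkFunctor (ModuleCat.{u} R) x

variable {R} in
/-- A morphism of sheaves of modules which induces isomorphisms on stalks is an isomorphism. -/
lemma isIso_of_isIso_stalk_map {F G : ModSheaf R X} (φ : F ⟶ G)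
    (h : ∀ x, IsIso ((stalk R x).map φ)) : IsIso φ :=
  have (x : X) : IsIso ((TopCat.Presheaf.stalkFunctor (ModuleCat.{u} R) x).map φ.1) := h x
  TopCat.Presheaf.isIso_of_stalkFunctor_map_iso φ

/-- The natural map from the stalk of the direct image to the stalk. -/
def stalkPushforward (f : X ⟶ Y) (x : X) : pushforward R f ⋙ stalk R (f x) ⟶ stalk R x where
  app F := TopCat.Presheaf.stalkPushforward _ f F.presheaf x
  naturality _ _ φ := TopCat.Presheaf.stalkPushforward_naturality f φ.hom x

/-- The natural map from the stalk at `f x` of a sheaf to the stalk at `x` of its inverse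
image. -/
def stalkToPullbackStalk (f : X ⟶ Y) (x : X) : stalk R (f x) ⟶ pullback R f ⋙ stalk R x where
  app G := (stalk R (f x)).map ((adjunction R f).unit.app G) ≫
    (stalkPushforward R f x).app ((pullback R f).obj G)
  naturality G G' φ := by
    have h := (adjunction R f).unit.naturality φ
    have h' := (stalkPushforward R f x).naturality ((pullback R f).map φ)
    dsimp at h h' ⊢
    rw [Category.assoc, ← h', ← Functor.map_comp_assoc, h, Functor.map_comp_assoc]

/-- A triangle identity read on stalks. As the first factor is invertible, it reduces the counit at
`x` to the map `(f_* F)_{f x} ⟶ F_x`. -/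
lemma stalkToPullbackStalk_counit (f : X ⟶ Y) (F : ModSheaf R X) (x : X) :
    (stalkToPullbackStalk R f x).app ((pushforward R f).obj F) ≫
        (stalk R x).map ((adjunction R f).counit.app F) = (stalkPushforward R f x).app F := by
  have h := (adjunction R f).right_triangle_components F
  have h' := (stalkPushforward R f x).naturality ((adjunction R f).counit.app F)
  dsimp [stalkToPullbackStalk] at h h' ⊢
  rw [Category.assoc, ← h', ← Functor.map_comp_assoc, h]
  simp

/-- The inverse image is the sheafified presheaf inverse image. The presheaf version has the right
stalks, and sheafification does not change them; the work is to check that these isomorphisms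
compose to the given map. -/
instance (f : X ⟶ Y) (G : ModSheaf R Y) (x : X) :
    IsIso ((stalkToPullbackStalk R f x).app G) := by
  let adj' := Functor.sheafPullbackConstruction.sheafAdjunctionContinuous (Opens.map f)
    (ModuleCat.{u} R) (Opens.grothendieckTopology Y) (Opens.grothendieckTopology X)
  let e := (adjunction R f).leftAdjointUniq adj'
  have h₁ : (adjunction R f).unit.app G ≫ (pushforward R f).map (e.hom.app G) =
      adj'.unit.app G := (adjunction R f).unit_leftAdjointUniq_hom_app adj' G
  let G₁ := (TopCat.Presheaf.pullback (ModuleCat.{u} R) f).obj G.presheaf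
  let τ := CategoryTheory.toSheafify (Opens.grothendieckTopology X) G₁
  -- The sheaf unit is the presheaf unit followed by the sheafification map.
  have h₂ : (adj'.unit.app G).hom =
      (TopCat.Presheaf.pullbackPushforwardAdjunction (ModuleCat.{u} R) f).unit.app G.presheaf ≫
        (TopCat.Presheaf.pushforward (ModuleCat.{u} R) f).map τ := by
    refine (Adjunction.map_restrictFullyFaithful_unit_app
      (((Opens.map f).op.lanAdjunction (ModuleCat.{u} R)).comp
        (sheafificationAdjunction (Opens.grothendieckTopology X) (ModuleCat.{u} R)))
      (fullyFaithfulSheafToPresheaf (Opens.grothendieckTopology Y) (ModuleCat.{u} R))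
      (Functor.FullyFaithful.id _)
      (L := Functor.sheafPullbackConstruction.sheafPullback (Opens.map f)
        (ModuleCat.{u} R) (Opens.grothendieckTopology Y) (Opens.grothendieckTopology X))
      (R := pushforward R f) (Iso.refl _) (Iso.refl _) G).trans ?_
    erw [CategoryTheory.Functor.map_id, Category.comp_id]
  have h₃ : IsIso (TopCat.Presheaf.stalkPullbackHom (ModuleCat.{u} R) f G.presheaf x) :=
    (TopCat.Presheaf.stalkPullbackIso (ModuleCat.{u} R) f G.presheaf x).isIso_hom
  have h₄ : IsIso ((TopCat.Presheaf.stalkFunctor (ModuleCat.{u} R) x).map τ) :=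
    TopCat.Presheaf.stalkFunctor_map_unit_toSheafify_isIso x (ModuleCat.{u} R) G₁
  have h₅ : (stalkToPullbackStalk R f x).app G ≫ (stalk R x).map (e.hom.app G) =
    TopCat.Presheaf.stalkPullbackHom (ModuleCat.{u} R) f G.presheaf x ≫
      (TopCat.Presheaf.stalkFunctor (ModuleCat.{u} R) x).map τ := by
    have h := (stalkPushforward R f x).naturality (e.hom.app G)
    dsimp [stalkToPullbackStalk] at h ⊢
    rw [Category.assoc, ← h, ← Functor.map_comp_assoc, h₁]
    have h' := TopCat.Presheaf.stalkPushforward_naturality f τ x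
    refine (congrArg (fun ψ ↦ (TopCat.Presheaf.stalkFunctor (ModuleCat.{u} R) (f x)).map ψ ≫
      TopCat.Presheaf.stalkPushforward _ f _ x) h₂).trans ?_
    refine Eq.trans (congrArg (· ≫ TopCat.Presheaf.stalkPushforward _ f _ x)
      (Functor.map_comp _ _ _)) ((Category.assoc _ _ _).trans ?_)
    exact (congrArg _ h').trans (Category.assoc _ _ _).symm
  have h₆ : IsIso ((stalk R x).map (e.hom.app G)) := ((stalk R x).mapIso (e.app G)).isIso_hom
  have h₇ : IsIso ((stalkToPullbackStalk R f x).app G ≫ (stalk R x).map (e.hom.app G)) := by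
    rw [h₅]
    exact IsIso.comp_isIso' h₃ h₄
  exact IsIso.of_isIso_comp_right _ ((stalk R x).map (e.hom.app G))

variable {R} in
/-- The inverse image functor for a surjective continuous map reflects isomorphisms. -/
lemma isIso_of_isIso_pullback_map (f : X ⟶ Y) (hf : Function.Surjective f) {G G' : ModSheaf R Y}
    (φ : G ⟶ G') [IsIso ((pullback R f).map φ)] : IsIso φ := by
  refine isIso_of_isIso_stalk_map φ fun y ↦ ?_
  obtain ⟨x, rfl⟩ := hf y
  have : IsIso ((stalk R (f x)).map φ ≫ (stalkToPullbackStalk R f x).app G') := by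
    rw [(stalkToPullbackStalk R f x).naturality φ]
    dsimp
    infer_instance
  exact IsIso.of_isIso_comp_right _ ((stalkToPullbackStalk R f x).app G')

end ModSheaf

/-! ### Acyclicity expressed by vanishing of `Ext`. -/

namespace CategoryTheory

open Abelian

variable {C : Type u₁} [Category.{v₁} C] [Abelian C] [HasExt.{w} C]
  {D : Type u₂} [Category.{v₂} D] [Abelian D]

/-- If `L ⊣ T` and `M` is projective, then `Extⁿ(L M, Y)` vanishes when `RⁿT(Y)` does. -/
lemma subsingleton_ext_of_isZero_rightDerived [EnoughInjectives C] {L : D ⥤ C} {T : C ⥤ D}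
    [T.Additive] (adj : L ⊣ T) (M : D) [Projective M] (Y : C) (n : ℕ)
    (h : IsZero ((T.rightDerived (n + 1)).obj Y)) : Subsingleton (Ext (L.obj M) Y (n + 1)) := by
  refine subsingleton_of_forall_eq 0 fun α ↦ ?_
  let I := injectiveResolution Y
  -- An `Ext` class is a cocycle `L M ⟶ Iⁿ⁺¹`. Its transpose `M ⟶ T Iⁿ⁺¹` is killed by the
  -- differential, hence lifts to `T Iⁿ` by exactness and projectivity of `M`; so the cocycle is a
  -- coboundary.
  obtain ⟨f, hf, rfl⟩ := I.extMk_surjective α (n + 2) rfl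
  rw [I.extMk_eq_zero_iff f _ _ _ n rfl]
  have hex : ((T.mapHomologicalComplex _).obj I.cocomplex).ExactAt (n + 1) := by
    rw [HomologicalComplex.exactAt_iff_isZero_homology]
    exact h.of_iso (I.isoRightDerivedObj T (n + 1)).symm
  rw [HomologicalComplex.exactAt_iff' _ n (n + 1) (n + 2) (by simp) (by simp)] at hex
  have hf' : adj.homEquiv _ _ f ≫ T.map (I.cocomplex.d (n + 1) (n + 2)) = 0 := by
    rw [← adj.homEquiv_naturality_right, hf, adj.homEquiv_unit, T.map_zero, comp_zero]
  let g : M ⟶ T.obj (I.cocomplex.X n) := hex.liftFromProjective (adj.homEquiv _ _ f) hf'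
  have hg : g ≫ T.map (I.cocomplex.d n (n + 1)) = adj.homEquiv _ _ f :=
    hex.liftFromProjective_comp _ _
  refine ⟨(adj.homEquiv _ _).symm g, (adj.homEquiv _ _).injective ?_⟩
  rw [adj.homEquiv_naturality_right, Equiv.apply_symm_apply, hg]

/-- The objects `Y` such that `Extⁿ(a i, Y) = 0` for all `i` and all `n > 0`. -/
def extAcyclic {ι : Type*} (a : ι → C) : ObjectProperty C :=
  fun Y ↦ ∀ i (n : ℕ), Subsingleton (Ext (a i) Y (n + 1))

/-- All closure properties come from the long exact sequence of `Ext (a i) _`. Vanishing of `Ext¹`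
lifts maps out of `a i` along `S.g`, which is what `hT` needs. -/
lemma extAcyclic_isAdaptedTo {ι : Type*} (a : ι → C) (T : C ⥤ D)
    (hT : ∀ {Y Z : C} (g : Y ⟶ Z),
      (∀ i, Function.Surjective (fun b : a i ⟶ Y ↦ b ≫ g)) → Epi (T.map g)) :
    (extAcyclic a).IsAdaptedTo T where
  of_injective I _ i n := Ext.subsingleton_of_injective _ _ _
  ext {S} hS h₁ h₃ i n := subsingleton_of_forall_eq 0 fun x ↦ by
    have := h₁ i n
    have := h₃ i n
    obtain ⟨y, rfl⟩ := Ext.covariant_sequence_exact₂ _ hS x (Subsingleton.elim _ _)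
    rw [Subsingleton.elim y 0, Ext.zero_comp]
  quotient {S} hS h₁ h₂ i n := subsingleton_of_forall_eq 0 fun x ↦ by
    have := h₁ i (n + 1)
    have := h₂ i n
    obtain ⟨y, rfl⟩ := Ext.covariant_sequence_exact₃ _ hS x rfl (Subsingleton.elim _ _)
    rw [Subsingleton.elim y 0, Ext.zero_comp]
  epi_map {S} hS h₁ := hT _ fun i x ↦ by
    have := h₁ i 0
    obtain ⟨y, hy⟩ := Ext.covariant_sequence_exact₃ _ hS (Ext.mk₀ x) (zero_add 1)
      (Subsingleton.elim _ _)
    obtain ⟨y, rfl⟩ := Ext.homEquiv₀.symm.surjective y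
    refine ⟨y, Ext.homEquiv₀.symm.injective ?_⟩
    simpa using hy

end CategoryTheory

namespace ModSheaf

variable (R : Type u) [CommRing R] {X : TopCat.{u}}

/-- The left adjoint of the functor `Γ(U, -)`. -/
def sectionsLeftAdjoint (U : Opens X) : ModuleCat.{u} R ⥤ ModSheaf R X :=
  evaluationLeftAdjoint _ (op U) ⋙ presheafToSheaf _ _

/-- The adjunction between `sectionsLeftAdjoint R U` and `Γ(U, -)`. -/
def sectionsAdjunction (U : Opens X) : sectionsLeftAdjoint R U ⊣ sections R U :=
  (evaluationAdjunctionRight _ (op U)).comp (sheafificationAdjunction _ _)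

/-- The sheaf which corepresents the sections over `U`. -/
abbrev freeSheaf (U : Opens X) : ModSheaf R X := (sectionsLeftAdjoint R U).obj (ModuleCat.of R R)

-- A section `s` over `U` is the image of `1` under a map `R ⟶ Γ(U, G)`, i.e. a map out of
-- `freeSheaf R U`; lifting that map lifts `s`.
variable {R} in
lemma sections_map_surjective {F G : ModSheaf R X} (g : F ⟶ G) (U : Opens X)
    (h : Function.Surjective (fun b : freeSheaf R U ⟶ F ↦ b ≫ g)) :
    Function.Surjective ((sections R U).map g) := by
  intro s
  let adj := sectionsAdjunction R U
  let s' : ModuleCat.of R R ⟶ (sections R U).obj G :=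
    ModuleCat.ofHom (LinearMap.toSpanSingleton R ((sections R U).obj G) s)
  obtain ⟨b, hb⟩ := h ((adj.homEquiv _ _).symm s')
  have hb' : adj.homEquiv _ _ b ≫ (sections R U).map g = s' := by
    rw [← adj.homEquiv_naturality_right]
    exact (congrArg (adj.homEquiv _ _) hb).trans (Equiv.apply_symm_apply _ _)
  refine ⟨(adj.homEquiv _ _ b) (1 : R), ?_⟩
  exact (congrArg (fun φ ↦ φ.hom (1 : R)) hb').trans (one_smul R s)

end ModSheaf

/-! ### Constant sheaves and inverse images. -/

namespace ModSheaf

variable {R : Type u} [CommRing R] {X Y Z : TopCat.{u}}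

variable (R) in
/-- The inverse image of a composition of continuous maps. -/
def pullbackCompIso (f : X ⟶ Y) (g : Y ⟶ Z) :
    pullback R g ⋙ pullback R f ≅ pullback R (f ≫ g) :=
  (((adjunction R g).comp (adjunction R f)).leftAdjointUniq
    (adjunction R (f ≫ g)))

variable (R) in
/-- Constant sheaves are left adjoint to the global sections. -/
def constantAdjunction (X : TopCat.{u}) :
    constantSheaf (Opens.grothendieckTopology X) (ModuleCat.{u} R) ⊣ sections R (X := X) ⊤ :=
  constantSheafAdj _ _ isTerminalTop

lemma IsConstant.of_iso {F G : ModSheaf R X} (hF : F.IsConstant) (e : F ≅ G) : G.IsConstant :=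
  ⟨Functor.essImage.ofIso e hF.mem_essImage⟩

/-- Since `Γ(Y, f_* F) = Γ(X, F)`, inverse images of constant sheaves and constant sheaves on `X`
are left adjoint to the same functor. -/
lemma isConstant_pullback (f : X ⟶ Y) {G : ModSheaf R Y} (hG : G.IsConstant) :
    ((pullback R f).obj G).IsConstant := by
  obtain ⟨M, ⟨e⟩⟩ := hG.mem_essImage
  have e' : constantSheaf (Opens.grothendieckTopology Y) (ModuleCat.{u} R) ⋙ pullback R f ≅
      constantSheaf (Opens.grothendieckTopology X) (ModuleCat.{u} R) :=
    ((constantAdjunction R Y).comp (adjunction R f)).leftAdjointUniq (constantAdjunction R X)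
  exact ⟨⟨M, ⟨e'.symm.app M ≪≫ (pullback R f).mapIso e⟩⟩⟩

/-- Every sheaf on a space with a single point is constant. -/
lemma isConstant_of_unique [Unique X] (F : ModSheaf R X) : F.IsConstant := by
  let J := Opens.grothendieckTopology X
  let M : ModuleCat.{u} R := F.presheaf.obj (op ⊤)
  let K : X.Presheaf (ModuleCat.{u} R) := (Functor.const _).obj M
  let ψ : K ⟶ F.presheaf :=
    { app U := F.presheaf.map (homOfLE le_top).op
      naturality U V i := by
        refine (Category.id_comp _).trans (Eq.trans ?_ (F.presheaf.map_comp _ _))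
        rfl }
  let φ : (constantSheaf J (ModuleCat.{u} R)).obj M ⟶ F :=
    ObjectProperty.homMk (sheafifyLift J ψ F.2)
  have fac : toSheafify J K ≫ φ.hom = ψ := toSheafify_sheafifyLift J ψ F.2
  have : IsIso φ := by
    refine isIso_of_isIso_stalk_map φ fun x ↦ ?_
    let st := TopCat.Presheaf.stalkFunctor (ModuleCat.{u} R) x
    -- The whole space is the only neighbourhood of `x`, so stalks are global sections, where `ψ` is
    -- the identity.
    have htop (U : Opens X) (hU : x ∈ U) : ⊤ ≤ U := fun y _ ↦ by
      rwa [Subsingleton.elim y x]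
    have h₁ : IsIso (st.map (toSheafify J K)) :=
      TopCat.Presheaf.stalkFunctor_map_unit_toSheafify_isIso x (ModuleCat.{u} R) K
    have h₂ := TopCat.Presheaf.isIso_germ_of_forall_le K x ⊤ trivial htop
    have h₃ := TopCat.Presheaf.isIso_germ_of_forall_le F.presheaf x ⊤ trivial htop
    have h₄ : IsIso (ψ.app (op ⊤)) := by
      dsimp [ψ]
      infer_instance
    have h₅ : IsIso (st.map ψ) := by
      have h := TopCat.Presheaf.stalkFunctor_map_germ ⊤ x trivial ψ
      have h' : IsIso (ψ.app (op ⊤) ≫ F.presheaf.germ ⊤ x trivial) := inferInstance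
      rw [← h] at h'
      exact @IsIso.of_isIso_comp_left _ _ _ _ _ _ _ h₂ h'
    have h₆ : st.map ψ = st.map (toSheafify J K) ≫ (stalk R x).map φ :=
      (congrArg st.map fac.symm).trans (st.map_comp _ _)
    rw [h₆] at h₅
    exact @IsIso.of_isIso_comp_left _ _ _ _ _ _ _ h₁ h₅
  exact ⟨⟨M, ⟨asIso φ⟩⟩⟩

/-- The inverse image of a sheaf by a constant map is constant. -/
lemma isConstant_pullback_of_forall_eq (f : X ⟶ Y) (y : Y) (hf : ∀ x, f x = y)
    (G : ModSheaf R Y) : ((pullback R f).obj G).IsConstant := by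
  let pt : TopCat.{u} := TopCat.of PUnit.{u + 1}
  let a : X ⟶ pt := TopCat.ofHom ⟨fun _ ↦ PUnit.unit, continuous_const⟩
  let b : pt ⟶ Y := TopCat.ofHom ⟨fun _ ↦ y, continuous_const⟩
  have hab : a ≫ b = f := by
    ext x
    exact (hf x).symm
  have : Unique pt := inferInstanceAs (Unique PUnit.{u + 1})
  have h := isConstant_pullback a (isConstant_of_unique ((pullback R b).obj G))
  subst hab
  exact h.of_iso ((pullbackCompIso R a b).app G)

end ModSheaf

/-! ### The space of strata and the stalks of `p_*`. -/

namespace Stratification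

variable {X : TopCat.{u}} (S : Stratification X) (R : Type u) [CommRing R]

lemma toStratum_eq_of_mem (A : S.Stratum) {x : X} (hx : x ∈ A.1) : S.toStratum x = A :=
  Subtype.ext (S.eq_of_mem (S.toStratum x).2 A.2 (S.mem_toStratum x) hx)

lemma nonempty (A : S.Stratum) : A.1.Nonempty :=
  Setoid.nonempty_of_mem_partition S.isPartition A.2

lemma proj_surjective : Function.Surjective S.proj := fun A ↦
  have ⟨x, hx⟩ := S.nonempty A
  ⟨x, S.toStratum_eq_of_mem A hx⟩

/-- The smallest open neighborhood of a point of the space of strata. -/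
def minOpen (A : S.Stratum) : Opens S.space where
  carrier := {B : S.Stratum | A.1 ⊆ closure B.1}
  is_open' := by
    refine isOpen_coinduced.2 ?_
    convert! (S.star A).isOpen using 1
    ext x
    exact ⟨fun hx ↦ ⟨_, ⟨(S.toStratum x).2, hx⟩, S.mem_toStratum x⟩,
      fun ⟨B, ⟨hB, hAB⟩, hx⟩ ↦ by
        rwa [Set.mem_preimage, S.toStratum_eq_of_mem ⟨B, hB⟩ hx]⟩

lemma mem_minOpen (A : S.Stratum) : A ∈ S.minOpen A := subset_closure

/-- The preimage of `U` is an open set containing a point of `A ⊆ closure B`, so it meets `B`; being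
saturated for `p`, it forces `B ∈ U`. -/
lemma minOpen_le (A : S.Stratum) (U : Opens S.space) (hA : A ∈ U) : S.minOpen A ≤ U := by
  intro B hB
  obtain ⟨x, hx⟩ := S.nonempty A
  have hU : IsOpen (S.toStratum ⁻¹' U) := isOpen_coinduced.1 U.isOpen
  obtain ⟨y, hy, hyB⟩ := mem_closure_iff.1 (hB hx) _ hU (by
    rwa [Set.mem_preimage, S.toStratum_eq_of_mem A hx])
  rwa [Set.mem_preimage, S.toStratum_eq_of_mem B hyB] at hy

/-- This identifies the stalk of `p_* F` at `A` with `Γ(St(A), F)`. -/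
lemma map_proj_obj_minOpen (A : S.Stratum) :
    (Opens.map S.proj).obj (S.minOpen A) = S.star A := by
  ext x
  exact ⟨fun hx ↦ ⟨_, ⟨(S.toStratum x).2, hx⟩, S.mem_toStratum x⟩,
    fun ⟨B, ⟨hB, hAB⟩, hx⟩ ↦ by
      change A.1 ⊆ closure (S.toStratum x).1
      rwa [S.toStratum_eq_of_mem ⟨B, hB⟩ hx]⟩

variable {R}

/-- Inverse images of sheaves on the space of strata are weakly constructible. -/
lemma weaklyConstructible_pullback (G : ModSheaf R S.space) :
    S.weaklyConstructible R ((ModSheaf.pullback R S.proj).obj G) := fun A ↦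
  (ModSheaf.isConstant_pullback_of_forall_eq (S.incl A ≫ S.proj) A
    (fun x ↦ S.toStratum_eq_of_mem A x.2) G).of_iso
    ((ModSheaf.pullbackCompIso R (S.incl A) S.proj).symm.app G)

/-- A morphism of sheaves on `X` that is surjective on the stars is mapped to an epimorphism by
the direct image functor `p_*`. -/
lemma epi_pushforward_map {F F' : ModSheaf R X} (g : F ⟶ F')
    (hg : ∀ A, Function.Surjective ((ModSheaf.sections R (S.star A)).map g)) :
    Epi ((ModSheaf.pushforward R S.proj).map g) := by
  rw [← TopCat.Sheaf.isLocallySurjective_iff_epi, TopCat.Presheaf.isLocallySurjective_iff]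
  intro U t A hA
  have h := hg A
  rw [← S.map_proj_obj_minOpen] at h
  exact ⟨S.minOpen A, S.minOpen_le A U hA, h _, S.mem_minOpen A⟩

/-- The counit `p^* p_* F ⟶ F` is an isomorphism if sections over stars are the same as germs. -/
lemma isIso_counit_app (F : ModSheaf R X)
    (hF : ∀ (A : S.Stratum) (x : X) (hx : x ∈ A.1),
      IsIso (F.presheaf.germ (S.star A) x (S.subset_star A hx))) :
    IsIso ((ModSheaf.adjunction R S.proj).counit.app F) := by
  refine ModSheaf.isIso_of_isIso_stalk_map _ fun x ↦ ?_
  have h := ModSheaf.stalkToPullbackStalk_counit R S.proj F x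
  have h₁ : IsIso ((ModSheaf.stalkPushforward R S.proj x).app F) := by
    let A := S.toStratum x
    have h₂ := TopCat.Presheaf.isIso_germ_of_forall_le
      (((ModSheaf.pushforward R S.proj).obj F).presheaf) (S.proj x) (S.minOpen A)
      (S.mem_minOpen A) (S.minOpen_le A)
    have h₃ : ((ModSheaf.pushforward R S.proj).obj F).presheaf.germ (S.minOpen A) (S.proj x)
      (S.mem_minOpen A) ≫ (ModSheaf.stalkPushforward R S.proj x).app F =
        F.presheaf.germ ((Opens.map S.proj).obj (S.minOpen A)) x (S.mem_minOpen A) :=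
      TopCat.Presheaf.stalkPushforward_germ _ _ _ _ _ _
    -- Quantifying over `U` allows transport along the equality of open sets between `p⁻¹(minOpen
    -- A)` and the star.
    have h₄ (U : Opens X) (hU : U = S.star A) (hx : x ∈ U) : IsIso (F.presheaf.germ U x hx) := by
      subst hU
      exact hF A x (S.mem_toStratum x)
    have h₅ := h₄ _ (S.map_proj_obj_minOpen A) (S.mem_minOpen A)
    rw [← h₃] at h₅
    exact @IsIso.of_isIso_comp_left _ _ _ _ _ _ _ h₂ h₅
  rw [← h] at h₁
  exact IsIso.of_isIso_comp_left ((ModSheaf.stalkToPullbackStalk R S.proj x).app _) _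

end Stratification

/-! ### Consequences of acyclicity for the derived adjunction. -/

namespace Stratification

variable {X : TopCat.{u}} (S : Stratification X) {R : Type u} [CommRing R]

/-- For an acyclic stratification, the unit `G ⟶ p_* p^* G` is an isomorphism. -/
lemma IsAcyclic.isIso_unit_app {S : Stratification X} (hS : S.IsAcyclic R)
    (G : ModSheaf R S.space) : IsIso ((ModSheaf.adjunction R S.proj).unit.app G) := by
  have h := (ModSheaf.adjunction R S.proj).left_triangle_components G
  have := S.isIso_counit_app _ (hS.isIso_germ _ (S.weaklyConstructible_pullback G))
  have : IsIso ((ModSheaf.pullback R S.proj).map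
      ((ModSheaf.adjunction R S.proj).unit.app G)) := by
    rw [← IsIso.eq_comp_inv, Category.id_comp] at h
    rw [h]
    infer_instance
  exact ModSheaf.isIso_of_isIso_pullback_map S.proj S.proj_surjective _

variable (R) in
/-- The sheaves without higher cohomology on stars, described by the vanishing of `Ext`. -/
def starAcyclic [HasExt.{w} (ModSheaf R X)] : ObjectProperty (ModSheaf R X) :=
  extAcyclic fun A : S.Stratum ↦ ModSheaf.freeSheaf R (S.star A)

lemma starAcyclic_isAdaptedTo [HasExt.{w} (ModSheaf R X)] :
    (S.starAcyclic R).IsAdaptedTo (ModSheaf.pushforward R S.proj) :=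
  extAcyclic_isAdaptedTo _ _ fun g hg ↦
    S.epi_pushforward_map g fun A ↦ ModSheaf.sections_map_surjective g _ (hg A)

/-- `freeSheaf` is the left adjoint of `Γ(St(A), -)` applied to the projective module `R`, so
vanishing cohomology gives vanishing `Ext`. -/
lemma IsAcyclicSheaf.starAcyclic [HasExt.{w} (ModSheaf R X)] {S : Stratification X}
    {F : ModSheaf R X} (hF : S.IsAcyclicSheaf R F) : S.starAcyclic R F := fun A n ↦
  subsingleton_ext_of_isZero_rightDerived (ModSheaf.sectionsAdjunction R (S.star A))
    (ModuleCat.of R R) F n (hF A (n + 1) n.succ_pos)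

lemma weaklyConstructible_of_iso {F G : ModSheaf R X} (hF : S.weaklyConstructible R F)
    (e : F ≅ G) : S.weaklyConstructible R G := fun A ↦
  (hF A).of_iso ((ModSheaf.pullback R (S.incl A)).mapIso e)

variable [HasDerivedCategory.{w₁} (ModSheaf R X)] [HasDerivedCategory.{w₂} (ModSheaf R S.space)]

lemma weaklyConstructiblePlus_pullbackPlus_obj (K : DerivedCategory.Plus (ModSheaf R S.space)) :
    S.weaklyConstructiblePlus R ((S.pullbackPlus R).obj K) := fun n ↦
  have ⟨e⟩ := (ModSheaf.pullback R S.proj).nonempty_homology_mapDerivedCategoryPlus_obj_iso K n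
  S.weaklyConstructible_of_iso (S.weaklyConstructible_pullback _) e.symm

-- Exactness of `p^*` identifies its cohomology with `p^*` of the cohomology. Conversely, if `p^* H
-- = 0` then `H ⟶ 0` becomes invertible after `p^*`, hence already is.
open ZeroObject in
lemma isLE_pullbackPlus_obj_iff (K : DerivedCategory.Plus (ModSheaf R S.space)) (n : ℤ) :
    ((S.pullbackPlus R).obj K).obj.IsLE n ↔ K.obj.IsLE n := by
  rw [DerivedCategory.isLE_iff, DerivedCategory.isLE_iff]
  refine forall₂_congr fun i _ ↦ ?_
  obtain ⟨e⟩ := (ModSheaf.pullback R S.proj).nonempty_homology_mapDerivedCategoryPlus_obj_iso K i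
  rw [e.isZero_iff]
  refine ⟨fun h ↦ ?_, fun h ↦ Functor.map_isZero _ h⟩
  have h₀ := isZero_zero (ModSheaf R S.space)
  let z : (DerivedCategory.homologyFunctor (ModSheaf R S.space) i).obj K.obj ⟶ 0 := 0
  have : IsIso ((ModSheaf.pullback R S.proj).map z) :=
    h.isIso (Functor.map_isZero _ h₀) _
  have := ModSheaf.isIso_of_isIso_pullback_map S.proj S.proj_surjective z
  exact h₀.of_iso (asIso z)

variable {S}

lemma IsAcyclic.isIso_derivedAdjunction_unit_app (hS : S.IsAcyclic R)
    (K : DerivedCategory.Plus (ModSheaf R S.space)) :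
    IsIso ((S.derivedAdjunction R).unit.app K) := by
  have := hasExt_of_hasDerivedCategory.{w₁} (ModSheaf R X)
  exact (ModSheaf.adjunction R S.proj).isIso_derivedPlus_unit_app S.starAcyclic_isAdaptedTo
    (fun G ↦ (hS.isAcyclicSheaf _ (S.weaklyConstructible_pullback G)).starAcyclic)
    hS.isIso_unit_app K

lemma IsAcyclic.isIso_derivedAdjunction_counit_app (hS : S.IsAcyclic R)
    (L : DerivedCategory.Plus (ModSheaf R X)) (hL : S.weaklyConstructiblePlus R L) :
    IsIso ((S.derivedAdjunction R).counit.app L) := by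
  have := hasExt_of_hasDerivedCategory.{w₁} (ModSheaf R X)
  exact (ModSheaf.adjunction R S.proj).isIso_derivedPlus_counit_app S.starAcyclic_isAdaptedTo L
    (fun n ↦ (hS.isAcyclicSheaf _ (hL n)).starAcyclic)
    (fun n ↦ S.isIso_counit_app _ (hS.isIso_germ _ (hL n)))

end Stratification

end

theorem mainTheorem5 {X : TopCat.{u}} (S : Stratification X) (R : Type u) [CommRing R]
    [HasDerivedCategory.{w₁} (ModSheaf R X)] [HasDerivedCategory.{w₂} (ModSheaf R S.space)]
    (hS : S.IsAcyclic R) :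
    (S.derivedAdjunction R).InducesEquivalence
      (𝟭 (DerivedCategory.Plus (ModSheaf R S.space)))
      (S.weaklyConstructiblePlus R).ι ∧
    (S.derivedAdjunction R).InducesEquivalence
      (DerivedCategory.boundedToPlus (ModSheaf R S.space))
      ((S.weaklyConstructibleBounded R).ι ⋙ DerivedCategory.boundedToPlus (ModSheaf R X)) := by
  constructor
  · exact (S.derivedAdjunction R).inducesEquivalence (Functor.FullyFaithful.id _)
      (S.weaklyConstructiblePlus R).fullyFaithfulι
      (G' := (S.weaklyConstructiblePlus R).lift (S.pullbackPlus R)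
        S.weaklyConstructiblePlus_pullbackPlus_obj)
      (F' := (S.weaklyConstructiblePlus R).ι ⋙ S.derivedPushforwardPlus R)
      (Iso.refl _) (Iso.refl _) hS.isIso_derivedAdjunction_unit_app
      (fun L ↦ hS.isIso_derivedAdjunction_counit_app L.obj L.property)
  · let iC := DerivedCategory.boundedToPlus (ModSheaf R S.space)
    let iD := (S.weaklyConstructibleBounded R).ι ⋙ DerivedCategory.boundedToPlus (ModSheaf R X)
    have hc (L : (S.weaklyConstructibleBounded R).FullSubcategory) :
        IsIso ((S.derivedAdjunction R).counit.app (iD.obj L)) :=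
      hS.isIso_derivedAdjunction_counit_app _ L.property
    have hb (K : DerivedCategory.Bounded (ModSheaf R S.space)) :
        (DerivedCategory.TStructure.t (C := ModSheaf R X)).bounded
          ((S.pullbackPlus R).obj (iC.obj K)).obj := by
      obtain ⟨n, hn⟩ := K.property.2
      exact ⟨((S.pullbackPlus R).obj (iC.obj K)).property,
        n, (S.isLE_pullbackPlus_obj_iff (iC.obj K) n).2 hn⟩
    -- The derived counit gives `p^* Rp_* L ≅ L`, so the upper bound for `L` descends to `Rp_* L`
    -- because `p^*` detects it.
    have hb' (L : (S.weaklyConstructibleBounded R).FullSubcategory) :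
        (DerivedCategory.TStructure.t (C := ModSheaf R S.space)).bounded
          ((S.derivedPushforwardPlus R).obj (iD.obj L)).obj := by
      obtain ⟨n, hn⟩ := L.obj.property.2
      refine ⟨((S.derivedPushforwardPlus R).obj (iD.obj L)).property, n,
        (S.isLE_pullbackPlus_obj_iff _ n).1 ?_⟩
      have : (iD.obj L).obj.IsLE n := hn
      let e : (iD.obj L).obj ≅
          ((S.pullbackPlus R).obj ((S.derivedPushforwardPlus R).obj (iD.obj L))).obj :=
        (DerivedCategory.Plus.ι.mapIso
          (asIso ((S.derivedAdjunction R).counit.app (iD.obj L)))).symm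
      exact DerivedCategory.TStructure.t.isLE_of_iso e n
    exact (S.derivedAdjunction R).inducesEquivalence
      (ObjectProperty.fullyFaithfulιOfLE _)
      ((S.weaklyConstructibleBounded R).fullyFaithfulι.comp (ObjectProperty.fullyFaithfulιOfLE _))
      (G' := (S.weaklyConstructibleBounded R).lift
        (ObjectProperty.lift _ (iC ⋙ S.pullbackPlus R ⋙ DerivedCategory.Plus.ι) hb)
        (fun K ↦ S.weaklyConstructiblePlus_pullbackPlus_obj (iC.obj K)))
      (F' := ObjectProperty.lift _ (iD ⋙ S.derivedPushforwardPlus R ⋙ DerivedCategory.Plus.ι) hb')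
      (Iso.refl _) (Iso.refl _) (fun K ↦ hS.isIso_derivedAdjunction_unit_app _) hc
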